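/- Let $G$ be a finite simple undirected graph of order $n\geq 1$ with degree sequence $d_1\geq d_2\geq\cdots\geq d_n$. The Slater number $s\ell(G)$ of $G$ is the minimum positive integer $s$ such that $(d_1+1)+\cdots+(d_s+1)\geq n$, and the domination number $\gamma(G)$ is the minimum order of a set $D$ of vertices of $G$ such that every vertex of $G$ outside $D$ has a neighbor in $D$. The graph $G$ is outerplanar if it can be embedded in the plane (vertices as distinct points, edges as Jordan arcs meeting only in common end vertices) such that all vertices lie on the boundary of the unbounded face. If $G$ is outerplanar and $s\ell(G)\geq 2$, then $$\gamma(G)\leq 6\,s\ell(G)-6.$$ -/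

import Mathlib

namespace SimpleGraph

/-- The Euclidean plane. -/
abbrev Plane : Type := EuclideanSpace ℝ (Fin 2)

/-- `A` is a (Jordan) arc with end points `p` and `q`: the image of an injective continuous map
of the closed unit interval into the plane that sends `0` to `p` and `1` to `q`. -/
def IsPlaneArc (A : Set Plane) (p q : Plane) : Prop :=
  ∃ γ : _root_.Path p q, Function.Injective γ ∧ Set.range γ = A

/-- A plane drawing (embedding in the plane) of a simple graph: vertices are distinct points,
every edge is an arc joining its two end vertices, an edge contains no vertex except for its
end vertices, and two different edges meet only in common end vertices. -/
structure PlaneDrawing {V : Type*} (G : SimpleGraph V) where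
  /-- the position of each vertex -/
  pos : V → Plane
  /-- the arc that represents each edge -/
  arc : G.edgeSet → Set Plane
  pos_injective : Function.Injective pos
  isPlaneArc_arc : ∀ (u v : V) (h : G.Adj u v),
    IsPlaneArc (arc ⟨s(u, v), G.mem_edgeSet.2 h⟩) (pos u) (pos v)
  mem_of_pos_mem_arc : ∀ (e : G.edgeSet) (w : V), pos w ∈ arc e → w ∈ (e : Sym2 V)
  arc_inter_arc_subset : ∀ e f : G.edgeSet, e ≠ f →
    arc e ∩ arc f ⊆ pos '' {w | w ∈ (e : Sym2 V) ∧ w ∈ (f : Sym2 V)}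

/-- The set of all points of the plane that are covered by the drawing. -/
def PlaneDrawing.carrier {V : Type*} {G : SimpleGraph V} (D : G.PlaneDrawing) : Set Plane :=
  Set.range D.pos ∪ ⋃ e : G.edgeSet, D.arc e

/-- The faces of a drawing are the connected components of its complement in the plane. -/
def PlaneDrawing.IsFace {V : Type*} {G : SimpleGraph V} (D : G.PlaneDrawing)
    (F : Set Plane) : Prop :=
  ∃ x ∈ D.carrierᶜ, F = connectedComponentIn D.carrierᶜ x

/-- A graph is outerplanar if it has a drawing in the plane such that all vertices lie on the
boundary of the unbounded face. -/
def IsOuterplanar {V : Type*} (G : SimpleGraph V) : Prop :=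
  ∃ (D : G.PlaneDrawing) (F : Set Plane),
    D.IsFace F ∧ ¬ Bornology.IsBounded F ∧ ∀ v : V, D.pos v ∈ frontier F

/-- `D` is a dominating set of `G`: every vertex outside `D` has a neighbor in `D`. -/
def IsDominatingSet {V : Type*} (G : SimpleGraph V) (D : Finset V) : Prop :=
  ∀ v : V, v ∉ D → ∃ u ∈ D, G.Adj v u

/-- The domination number: the minimum order of a dominating set
(the set of all vertices is always one). -/
noncomputable def dominationNumber {V : Type*} (G : SimpleGraph V) : ℕ :=
  sInf {k : ℕ | ∃ D : Finset V, G.IsDominatingSet D ∧ D.card = k}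

/-- The degree sequence `d₁ ≥ d₂ ≥ ⋯ ≥ dₙ` of a finite graph. -/
def degreeSequence {V : Type*} [Fintype V] (G : SimpleGraph V) [DecidableRel G.Adj] : List ℕ :=
  (Finset.univ.val.map fun v : V => G.degree v).sort (· ≥ ·)

/-- The Slater number: the minimum positive integer `s` such that
`(d₁ + 1) + ⋯ + (dₛ + 1) ≥ n`, where `n` is the order and `d₁ ≥ ⋯ ≥ dₙ` the degree sequence.
For `n ≥ 1`, the integer `s = n` always qualifies. -/
noncomputable def slaterNumber {V : Type*} [Fintype V] (G : SimpleGraph V)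
    [DecidableRel G.Adj] : ℕ :=
  sInf {s : ℕ | 0 < s ∧ Fintype.card V ≤ ((G.degreeSequence.take s).map (· + 1)).sum}

end SimpleGraph

/-! Let `D` consist of `s` vertices of largest degree, where `s` is the Slater number, so that the
closed neighborhoods of `D` have total size at least `n`. Every vertex missed by all of them has to
be compensated by multiple coverings elsewhere, so the number of missed vertices is at most the
excess `coverExcess`, in which a vertex covered `c ≥ 1` times counts `c - 1`. Adding the missed
vertices to `D` gives a dominating set (`dominationNumber_le_card_add_coverExcess`). It remains to
show that the excess is at most `5 * s - 6`, since `s + (5 * s - 6) = 6 * s - 6`.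

This bound (`coverExcess_add_six_le`) holds for every finite graph without `K₄` and `K₂,₃` minors
and every `D` with at least two elements. By `exists_ncard_neighbors_le_two`, some `x ∈ D` has at
most two neighbors in `D`. If it has one, contracting that edge removes one element of `D` and at
most five from the excess. Otherwise `x` is either erased without loss or merged with a neighbor
outside `D`.

The two minors are excluded topologically. A point of the face whose boundary contains all vertices
serves as an extra vertex (`PlaneDrawing.exists_apex`), turning a `K₄` or `K₂,₃` minor into a
drawing of `K₅` or `K₃,₃` in which independent edges are disjoint. Such drawings contradict a parity
relation between winding numbers (`exists_winding_relation`). -/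

namespace SimpleGraph

/-! ### Winding numbers and the nonplanarity of `K₅` and `K₃,₃` -/

open Complex

/-- A nowhere vanishing continuous function on a contractible space has a continuous logarithm. -/
theorem exists_continuous_log {A : Type*} [TopologicalSpace A] [ContractibleSpace A]
    [LocallyPathConnectedSpace A] [Nonempty A] (g : A → ℂ) (hg : Continuous g)
    (h0 : ∀ a, g a ≠ 0) : ∃ L : A → ℂ, Continuous L ∧ ∀ a, exp (L a) = g a := by
  obtain ⟨a₀⟩ := ‹Nonempty A›
  obtain ⟨F, ⟨-, hF⟩, -⟩ := isCoveringMapOn_exp.existsUnique_continuousMap_lifts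
    (⟨g, hg⟩ : C(A, ℂ)) (a₀ := a₀) (exp_log (h0 a₀)) (fun a => h0 a)
  exact ⟨F, F.continuous, fun a => congrFun hF a⟩

/-- Two continuous functions on the line with proportional exponentials have the same
increments. -/
theorem increment_eq_of_exp_eq_mul {L M : ℝ → ℂ} (hL : Continuous L) (hM : Continuous M) (c : ℂ)
    (h : ∀ t, exp (L t) = c * exp (M t)) : L 1 - L 0 = M 1 - M 0 := by
  have hc : ∀ t, exp (L t - M t) = c := fun t => by
    rw [exp_sub, h, mul_div_assoc, div_self (exp_ne_zero _), mul_one]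
  have hconst : ∀ t s, L t - M t = L s - M s := by
    have hd : Continuous fun t => ((L t - M t) - (L 0 - M 0)) / (2 * Real.pi * I) := by fun_prop
    have hZ : ∀ t, ∃ n : ℤ, ((L t - M t) - (L 0 - M 0)) / (2 * Real.pi * I) = n := by
      intro t
      obtain ⟨n, hn⟩ := exp_eq_exp_iff_exists_int.1 ((hc t).trans (hc 0).symm)
      refine ⟨n, ?_⟩
      rw [hn, add_sub_cancel_left, mul_div_assoc, div_self two_pi_I_ne_zero, mul_one]
    choose n hn using hZ
    have hnc : Continuous n := by
      rw [Int.isClosedEmbedding_coe_real.isEmbedding.continuous_iff]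
      have : (fun t => ((n t : ℤ) : ℝ)) = fun t =>
          (((L t - M t) - (L 0 - M 0)) / (2 * Real.pi * I)).re := by
        funext t; rw [hn t]; simp
      show Continuous (fun t => ((n t : ℤ) : ℝ))
      rw [this]
      exact continuous_re.comp hd
    intro t s
    have h1 : n t = n s := PreconnectedSpace.constant inferInstance hnc
    have h2 := (hn t).trans ((congrArg _ h1).trans (hn s).symm)
    rw [div_left_inj' two_pi_I_ne_zero] at h2
    linear_combination h2
  linear_combination hconst 1 0

/-- `w` is the change of a continuous logarithm of `γ - v` along the path `γ`. -/
def IsLogIncrement {a b : ℂ} (γ : _root_.Path a b) (v w : ℂ) : Prop :=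
  ∃ L : ℝ → ℂ, Continuous L ∧ (∀ t, exp (L t) = γ.extend t - v) ∧ L 1 - L 0 = w

theorem exists_isLogIncrement {a b v : ℂ} (γ : _root_.Path a b) (hv : v ∉ Set.range γ) :
    ∃ w, IsLogIncrement γ v w := by
  obtain ⟨L, hL, h⟩ := exists_continuous_log (fun t : ℝ => γ.extend t - v)
    (γ.continuous_extend.sub continuous_const) (fun t ht => hv (by
      rw [← γ.extend_range]; exact ⟨t, sub_eq_zero.1 ht⟩))
  exact ⟨_, L, hL, h, rfl⟩

theorem IsLogIncrement.eq_of_exp_eq_mul {a b v w : ℂ} {γ : _root_.Path a b}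
    (h : IsLogIncrement γ v w) {M : ℝ → ℂ} (hM : Continuous M) (c : ℂ)
    (hc : ∀ t, γ.extend t - v = c * exp (M t)) : w = M 1 - M 0 := by
  obtain ⟨L, hL, h1, rfl⟩ := h
  exact increment_eq_of_exp_eq_mul hL hM c fun t => (h1 t).trans (hc t)

theorem IsLogIncrement.exp_mul {a b v w : ℂ} {γ : _root_.Path a b}
    (h : IsLogIncrement γ v w) : exp w * (a - v) = b - v := by
  obtain ⟨L, hL, h1, rfl⟩ := h
  have h0 := h1 0
  have h2 := h1 1
  simp only [_root_.Path.extend_zero, _root_.Path.extend_one] at h0 h2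
  rw [← h0, ← h2, ← exp_add, sub_add_cancel]

/-- The total change of the argument of `δ - γ` around the boundary of the unit square is zero
when the paths `γ` and `δ` are disjoint. -/
theorem IsLogIncrement.add_eq_add {a b c d : ℂ} {γ : _root_.Path a b} {δ : _root_.Path c d}
    (hd : Disjoint (Set.range γ) (Set.range δ)) {wa wb wc wd : ℂ}
    (ha : IsLogIncrement δ a wa) (hb : IsLogIncrement δ b wb)
    (hc : IsLogIncrement γ c wc) (hdd : IsLogIncrement γ d wd) : wc + wb = wa + wd := by
  obtain ⟨L, hL, h⟩ := exists_continuous_log (fun p : ℝ × ℝ => δ.extend p.2 - γ.extend p.1)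
    ((δ.continuous_extend.comp continuous_snd).sub (γ.continuous_extend.comp continuous_fst))
    (fun p hp => Set.disjoint_left.1 hd
      (show γ.extend p.1 ∈ Set.range γ by rw [← γ.extend_range]; exact ⟨_, rfl⟩)
      (by rw [← δ.extend_range]; exact ⟨p.2, sub_eq_zero.1 hp⟩))
  have e1 := ha.eq_of_exp_eq_mul (M := fun t => L (0, t)) (by fun_prop) 1
    (fun t => by simp [h])
  have e2 := hb.eq_of_exp_eq_mul (M := fun t => L (1, t)) (by fun_prop) 1
    (fun t => by simp [h])
  -- On these two sides of the square the function is an end point of `δ` minus `γ`, hence the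
  -- constant `-1`.
  have e3 := hc.eq_of_exp_eq_mul (M := fun t => L (t, 0)) (by fun_prop) (-1)
    (fun t => by simp [h])
  have e4 := hdd.eq_of_exp_eq_mul (M := fun t => L (t, 1)) (by fun_prop) (-1)
    (fun t => by simp [h])
  rw [e1, e2, e3, e4]; ring

/-- The sign of a pair of indices. -/
def orderSign {ι : Type*} [LinearOrder ι] (i j : ι) : ℤ := if i < j then -1 else 1

open Classical in
/-- A parity relation between the winding numbers of disjoint paths that join given points. -/
theorem exists_winding_relation {ι : Type*} [LinearOrder ι] (p : ι → ℂ)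
    (γ : ∀ i j, _root_.Path (p i) (p j)) :
    ∃ k : ι → ι → ι → ℤ, ∀ a b c d, a ≠ c → a ≠ d → b ≠ c → b ≠ d →
      Disjoint (Set.range (γ a b)) (Set.range (γ c d)) →
      2 * (k c a b + k b c d - k a c d - k d a b) + orderSign c b + orderSign a c
        + orderSign b d + orderSign d a = 0 := by
  -- A fixed logarithm of `p v - p u` for each ordered pair, arranged so that exchanging `u` and `v`
  -- changes it by exactly `±π * I`. The integers `k` then measure how far the true increments along
  -- paths are from differences of these logarithms.
  set α : ι → ι → ℂ := fun u v => if u < v then log (p v - p u) else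
    log (p u - p v) + Real.pi * I with hα
  have hexp : ∀ u v, p u ≠ p v → exp (α u v) = p v - p u := by
    intro u v h
    simp only [hα]
    split_ifs
    · exact exp_log (sub_ne_zero.2 h.symm)
    · rw [exp_add, exp_log (sub_ne_zero.2 h), exp_pi_mul_I]; ring
  have hsign : ∀ u v, u ≠ v → α u v - α v u = orderSign u v * (Real.pi * I) := by
    intro u v h
    rcases h.lt_or_gt with h | h
    · simp [hα, orderSign, h, h.not_gt]
    · simp [hα, orderSign, h, h.not_gt]
  have key : ∀ v a b, ∃ k : ℤ, v ≠ a → v ≠ b → p v ∉ Set.range (γ a b) →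
      IsLogIncrement (γ a b) (p v) (α v b - α v a + k * (2 * Real.pi * I)) := by
    intro v a b
    by_cases hv : p v ∈ Set.range (γ a b)
    · exact ⟨0, fun _ _ h => (h hv).elim⟩
    obtain ⟨w, hw⟩ := exists_isLogIncrement (γ a b) hv
    have hva : p v ≠ p a := fun h => hv ⟨0, by rw [(γ a b).source, h]⟩
    have hvb : p v ≠ p b := fun h => hv ⟨1, by rw [(γ a b).target, h]⟩
    have h1 : exp w = exp (α v b - α v a) := by
      rw [exp_sub, hexp _ _ hva, hexp _ _ hvb, eq_div_iff (sub_ne_zero.2 hva.symm)]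
      exact hw.exp_mul
    obtain ⟨n, hn⟩ := exp_eq_exp_iff_exists_int.1 h1
    exact ⟨n, fun _ _ _ => hn ▸ hw⟩
  choose k hk using key
  refine ⟨k, fun a b c d hac had hbc hbd hdis => ?_⟩
  have m0 : ∀ i j, p i ∈ Set.range (γ i j) := fun i j => ⟨0, by simp⟩
  have m1 : ∀ i j, p j ∈ Set.range (γ i j) := fun i j => ⟨1, by simp⟩
  have e := IsLogIncrement.add_eq_add hdis
    (hk a c d hac had (Set.disjoint_left.1 hdis (m0 a b)))
    (hk b c d hbc hbd (Set.disjoint_left.1 hdis (m1 a b)))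
    (hk c a b hac.symm hbc.symm (Set.disjoint_right.1 hdis (m0 c d)))
    (hk d a b had.symm hbd.symm (Set.disjoint_right.1 hdis (m1 c d)))
  have s1 := hsign c b hbc.symm
  have s2 := hsign a c hac
  have s3 := hsign b d hbd
  have s4 := hsign d a had.symm
  have hne : (Real.pi * I : ℂ) ≠ 0 := by simp [Real.pi_ne_zero]
  have : ((2 * (k c a b + k b c d - k a c d - k d a b) + orderSign c b + orderSign a c
        + orderSign b d + orderSign d a : ℤ) : ℂ) * (Real.pi * I) = 0 := by
    push_cast
    linear_combination e - s1 - s2 - s3 - s4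
  exact_mod_cast (mul_eq_zero.1 this).resolve_right hne

/-- No continuous drawing of `K₅` has pairwise disjoint independent edges. -/
theorem not_exists_drawing_five (p : Fin 5 → ℂ) (S : Fin 5 → Fin 5 → Set ℂ)
    (hj : ∀ i j, i < j → JoinedIn (S i j) (p i) (p j))
    (hd : ∀ i j k l, i < j → k < l → i ≠ k → i ≠ l → j ≠ k → j ≠ l →
      Disjoint (S i j) (S k l)) : False := by
  classical
  have hJ : ∀ i j, Joined (p i) (p j) := fun i j => PathConnectedSpace.joined _ _
  obtain ⟨k, hk⟩ := exists_winding_relation p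
    (fun i j => if h : i < j then (hj i j h).somePath else (hJ i j).somePath)
  have K : ∀ a b c d, a < b → c < d → a ≠ c → a ≠ d → b ≠ c → b ≠ d →
      2 * (k c a b + k b c d - k a c d - k d a b) + orderSign c b + orderSign a c
        + orderSign b d + orderSign d a = 0 := by
    intro a b c d hab hcd h1 h2 h3 h4
    refine hk a b c d h1 h2 h3 h4 ?_
    simp only [hab, hcd, dif_pos]
    refine (hd a b c d hab hcd h1 h2 h3 h4).mono ?_ ?_ <;>
    · rintro _ ⟨t, rfl⟩
      exact JoinedIn.somePath_mem _ _
  -- The 15 pairs of independent edges of `K₅`. Each integer `k v a b` occurs in two of the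
  -- relations, so after summation the `k` terms vanish modulo 4. The sign terms give `-2` for a
  -- pair with interleaved ends and `0` otherwise. Each of the five 4-subsets has one interleaved
  -- pair, so the sum is `-10`, which is `2` modulo 4.
  have e0 := K 0 1 2 3 (by decide) (by decide) (by decide) (by decide) (by decide) (by decide)
  have e1 := K 0 1 2 4 (by decide) (by decide) (by decide) (by decide) (by decide) (by decide)
  have e2 := K 0 1 3 4 (by decide) (by decide) (by decide) (by decide) (by decide) (by decide)
  have e3 := K 0 2 1 3 (by decide) (by decide) (by decide) (by decide) (by decide) (by decide)
  have e4 := K 0 2 1 4 (by decide) (by decide) (by decide) (by decide) (by decide) (by decide)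
  have e5 := K 0 2 3 4 (by decide) (by decide) (by decide) (by decide) (by decide) (by decide)
  have e6 := K 0 3 1 2 (by decide) (by decide) (by decide) (by decide) (by decide) (by decide)
  have e7 := K 0 3 1 4 (by decide) (by decide) (by decide) (by decide) (by decide) (by decide)
  have e8 := K 0 3 2 4 (by decide) (by decide) (by decide) (by decide) (by decide) (by decide)
  have e9 := K 0 4 1 2 (by decide) (by decide) (by decide) (by decide) (by decide) (by decide)
  have f0 := K 0 4 1 3 (by decide) (by decide) (by decide) (by decide) (by decide) (by decide)
  have f1 := K 0 4 2 3 (by decide) (by decide) (by decide) (by decide) (by decide) (by decide)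
  have f2 := K 1 2 3 4 (by decide) (by decide) (by decide) (by decide) (by decide) (by decide)
  have f3 := K 1 3 2 4 (by decide) (by decide) (by decide) (by decide) (by decide) (by decide)
  have f4 := K 1 4 2 3 (by decide) (by decide) (by decide) (by decide) (by decide) (by decide)
  simp [orderSign] at e0 e1 e2 e3 e4 e5 e6 e7 e8 e9 f0 f1 f2 f3 f4
  omega

/-- No continuous drawing of `K₃,₃` has pairwise disjoint independent edges. -/
theorem not_exists_drawing_three_three (x y : Fin 3 → ℂ) (S : Fin 3 → Fin 3 → Set ℂ)
    (hj : ∀ i j, JoinedIn (S i j) (x i) (y j))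
    (hd : ∀ i j i' j', i ≠ i' → j ≠ j' → Disjoint (S i j) (S i' j')) : False := by
  have hJ : ∀ u v : ℂ, Joined u v := fun u v => PathConnectedSpace.joined _ _
  let p : Fin 3 ⊕ₗ Fin 3 → ℂ := fun i => Sum.elim x y (ofLex i)
  let γ : ∀ i j, _root_.Path (p i) (p j) := fun i j => match i, j with
    | Sum.inlₗ i, Sum.inrₗ j => (hj i j).somePath
    | i, j => (hJ (p i) (p j)).somePath
  obtain ⟨k, hk⟩ := exists_winding_relation p γ
  have K : ∀ i j i' j', i ≠ i' → j ≠ j' →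
      2 * (k (Sum.inlₗ i') (Sum.inlₗ i) (Sum.inrₗ j) + k (Sum.inrₗ j) (Sum.inlₗ i') (Sum.inrₗ j')
        - k (Sum.inlₗ i) (Sum.inlₗ i') (Sum.inrₗ j') - k (Sum.inrₗ j') (Sum.inlₗ i) (Sum.inrₗ j))
        + orderSign i i' + orderSign j j' = 0 := by
    intro i j i' j' hi hj'
    have h := hk (Sum.inlₗ i) (Sum.inrₗ j) (Sum.inlₗ i') (Sum.inrₗ j')
      (by simpa [Sum.inlₗ] using hi) (by simp [Sum.inlₗ, Sum.inrₗ])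
      (by simp [Sum.inlₗ, Sum.inrₗ]) (by simpa [Sum.inrₗ] using hj') (by
        refine (hd i j i' j' hi hj').mono ?_ ?_ <;>
        · rintro _ ⟨t, rfl⟩
          exact JoinedIn.somePath_mem _ _)
    have h1 : orderSign (Sum.inlₗ i' : Fin 3 ⊕ₗ Fin 3) (Sum.inrₗ j) = -1 :=
      if_pos (Sum.Lex.inl_lt_inr _ _)
    have h2 : orderSign (Sum.inrₗ j' : Fin 3 ⊕ₗ Fin 3) (Sum.inlₗ i) = 1 :=
      if_neg Sum.Lex.not_inr_lt_inl
    have h3 : orderSign (Sum.inlₗ i : Fin 3 ⊕ₗ Fin 3) (Sum.inlₗ i') = orderSign i i' :=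
      if_congr Sum.Lex.inl_lt_inl_iff rfl rfl
    have h4 : orderSign (Sum.inrₗ j : Fin 3 ⊕ₗ Fin 3) (Sum.inrₗ j') = orderSign j j' :=
      if_congr Sum.Lex.inr_lt_inr_iff rfl rfl
    rw [h1, h2, h3, h4] at h
    linarith
  -- The 18 pairs of independent edges of `K₃,₃`. Again each `k` term occurs twice, and the sign
  -- terms contribute `-2` in the nine cases with `j < j'` and `0` in the others: the sum `-18` is
  -- not divisible by 4.
  have e0 := K 0 0 1 1 (by decide) (by decide)
  have e1 := K 0 0 1 2 (by decide) (by decide)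
  have e2 := K 0 1 1 0 (by decide) (by decide)
  have e3 := K 0 1 1 2 (by decide) (by decide)
  have e4 := K 0 2 1 0 (by decide) (by decide)
  have e5 := K 0 2 1 1 (by decide) (by decide)
  have e6 := K 0 0 2 1 (by decide) (by decide)
  have e7 := K 0 0 2 2 (by decide) (by decide)
  have e8 := K 0 1 2 0 (by decide) (by decide)
  have f0 := K 0 1 2 2 (by decide) (by decide)
  have f1 := K 0 2 2 0 (by decide) (by decide)
  have f2 := K 0 2 2 1 (by decide) (by decide)
  have f3 := K 1 0 2 1 (by decide) (by decide)
  have f4 := K 1 0 2 2 (by decide) (by decide)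
  have f5 := K 1 1 2 0 (by decide) (by decide)
  have f6 := K 1 1 2 2 (by decide) (by decide)
  have f7 := K 1 2 2 0 (by decide) (by decide)
  have f8 := K 1 2 2 1 (by decide) (by decide)
  simp [orderSign] at e0 e1 e2 e3 e4 e5 e6 e7 e8 f0 f1 f2 f3 f4 f5 f6 f7 f8
  omega

end SimpleGraph

/-! ### Minors in plane drawings and the forbidden minors of outerplanar graphs -/

namespace SimpleGraph

variable {V W : Type*}

/-- Any two vertices of `S` can be linked by a walk inside `S`. -/
def LinkedIn (G : SimpleGraph V) (S : Set V) : V → V → Prop :=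
  Relation.ReflTransGen fun a b => G.Adj a b ∧ a ∈ S ∧ b ∈ S

theorem LinkedIn.symm {G : SimpleGraph V} {S : Set V} {u v : V} (h : G.LinkedIn S u v) :
    G.LinkedIn S v u := by
  induction h with
  | refl => exact .refl
  | tail _ h ih => exact .head ⟨h.1.symm, h.2.2, h.2.1⟩ ih

/-- A nonempty set of vertices that induces a connected subgraph. -/
def ConnectedOn (G : SimpleGraph V) (S : Set V) : Prop :=
  S.Nonempty ∧ ∀ u ∈ S, ∀ v ∈ S, G.LinkedIn S u v

theorem connectedOn_of_root {G : SimpleGraph V} {S : Set V} {r : V} (hr : r ∈ S)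
    (h : ∀ v ∈ S, G.LinkedIn S r v) : G.ConnectedOn S :=
  ⟨⟨r, hr⟩, fun u hu v hv => (h u hu).symm.trans (h v hv)⟩

theorem connectedOn_singleton (G : SimpleGraph V) (v : V) : G.ConnectedOn {v} :=
  connectedOn_of_root rfl fun u hu => by rw [Set.mem_singleton_iff.1 hu]; exact .refl

/-- `K` is a minor of `G`: there are disjoint connected branch sets in `G`, with an edge between
any two of them that belong to adjacent vertices of `K`. -/
def HasMinor (K : SimpleGraph W) (G : SimpleGraph V) : Prop :=
  ∃ B : W → Set V, (∀ i, G.ConnectedOn (B i)) ∧ (∀ i j, i ≠ j → Disjoint (B i) (B j)) ∧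
    ∀ i j, K.Adj i j → ∃ u ∈ B i, ∃ v ∈ B j, G.Adj u v

/-- The part of a drawing that belongs to the subgraph induced by a set of vertices. -/
def PlaneDrawing.carrierOn {G : SimpleGraph V} (D : G.PlaneDrawing) (C : Set V) : Set Plane :=
  D.pos '' C ∪ ⋃ e ∈ {e : G.edgeSet | ∀ v ∈ (e : Sym2 V), v ∈ C}, D.arc e

namespace PlaneDrawing

variable {G : SimpleGraph V} (D : G.PlaneDrawing)

theorem carrierOn_subset (C : Set V) : D.carrierOn C ⊆ D.carrier := by
  rintro x (⟨v, -, rfl⟩ | hx)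
  · exact Or.inl ⟨v, rfl⟩
  · simp only [Set.mem_iUnion] at hx
    obtain ⟨e, -, hx⟩ := hx
    exact Or.inr (Set.mem_iUnion.2 ⟨e, hx⟩)

theorem carrierOn_mono {C C' : Set V} (h : C ⊆ C') : D.carrierOn C ⊆ D.carrierOn C' :=
  Set.union_subset_union (Set.image_mono h)
    (Set.biUnion_subset_biUnion_left fun _ he v hv => h (he v hv))

theorem isCompact_arc (e : G.edgeSet) : IsCompact (D.arc e) := by
  obtain ⟨e, he⟩ := e
  induction e using Sym2.ind with
  | _ u v =>
    obtain ⟨γ, -, h⟩ := D.isPlaneArc_arc u v he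
    rw [← h]
    exact isCompact_range γ.continuous

theorem isClosed_carrierOn [Finite V] (C : Set V) : IsClosed (D.carrierOn C) :=
  (C.toFinite.image _).isClosed.union
    ((Set.toFinite _).isClosed_biUnion fun e _ => (D.isCompact_arc e).isClosed)

theorem isClosed_carrier [Finite V] : IsClosed D.carrier :=
  (Set.finite_range _).isClosed.union
    (isClosed_iUnion_of_finite fun e => (D.isCompact_arc e).isClosed)

theorem pos_notMem_carrierOn {C : Set V} {v : V} (hv : v ∉ C) : D.pos v ∉ D.carrierOn C := by
  rintro (⟨u, hu, h⟩ | hx)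
  · exact hv (D.pos_injective h ▸ hu)
  · simp only [Set.mem_iUnion] at hx
    obtain ⟨e, he, hx⟩ := hx
    exact hv (he v (D.mem_of_pos_mem_arc e v hx))

theorem disjoint_carrierOn {C C' : Set V} (h : Disjoint C C') :
    Disjoint (D.carrierOn C) (D.carrierOn C') := by
  have hd := Set.disjoint_left.1 h
  rw [Set.disjoint_left]
  rintro x (⟨v, hv, rfl⟩ | hx) hx'
  · exact D.pos_notMem_carrierOn (hd hv) hx'
  · simp only [Set.mem_iUnion] at hx
    obtain ⟨e, he, hx⟩ := hx
    rcases hx' with ⟨v, hv, rfl⟩ | hx'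
    · exact hd (he v (D.mem_of_pos_mem_arc e v hx)) hv
    · simp only [Set.mem_iUnion] at hx'
      obtain ⟨f, hf, hx'⟩ := hx'
      have hef : e ≠ f := by
        rintro rfl
        have := Sym2.out_fst_mem (e : Sym2 V)
        exact hd (he _ this) (hf _ this)
      obtain ⟨w, ⟨hw, hw'⟩, -⟩ := D.arc_inter_arc_subset e f hef ⟨hx, hx'⟩
      exact hd (he _ hw) (hf _ hw')

theorem joinedIn_carrierOn_of_adj {C : Set V} {u v : V} (hu : u ∈ C) (hv : v ∈ C)
    (h : G.Adj u v) : JoinedIn (D.carrierOn C) (D.pos u) (D.pos v) := by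
  obtain ⟨γ, -, hγ⟩ := D.isPlaneArc_arc u v h
  refine ⟨γ, fun t => Or.inr (Set.mem_iUnion₂.2 ⟨⟨s(u, v), G.mem_edgeSet.2 h⟩, ?_, ?_⟩)⟩
  · intro w hw
    rcases Sym2.mem_iff.1 hw with rfl | rfl <;> assumption
  · rw [← hγ]; exact ⟨t, rfl⟩

theorem joinedIn_carrierOn_of_linkedIn {C : Set V} {u v : V} (hu : u ∈ C)
    (h : G.LinkedIn C u v) : JoinedIn (D.carrierOn C) (D.pos u) (D.pos v) := by
  induction h with
  | refl => exact JoinedIn.refl (Or.inl ⟨u, hu, rfl⟩)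
  | tail _ h ih => exact ih.trans (D.joinedIn_carrierOn_of_adj h.2.1 h.2.2 h.1)

/-- Two adjacent branch sets can be joined inside the drawing of their union. -/
theorem joinedIn_carrierOn_union {B C : Set V} (hB : G.ConnectedOn B) (hC : G.ConnectedOn C)
    {u v : V} (hu : u ∈ B) (hv : v ∈ C) (h : ∃ x ∈ B, ∃ y ∈ C, G.Adj x y) :
    JoinedIn (D.carrierOn (B ∪ C)) (D.pos u) (D.pos v) := by
  obtain ⟨x, hx, y, hy, h⟩ := h
  exact ((D.joinedIn_carrierOn_of_linkedIn hu (hB.2 u hu x hx)).mono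
      (D.carrierOn_mono Set.subset_union_left)).trans
    ((D.joinedIn_carrierOn_of_adj (Or.inl hx) (Or.inr hy) h).trans
      ((D.joinedIn_carrierOn_of_linkedIn hy (hC.2 y hy v hv)).mono
        (D.carrierOn_mono Set.subset_union_right)))

/-- If all vertices lie on the boundary of a face, then they can be joined to a point of the face
by sets that avoid everything not incident with them. -/
theorem exists_apex [Finite V] {F : Set Plane} (hF : D.IsFace F)
    (hv : ∀ v, D.pos v ∈ frontier F) : ∃ (w : Plane) (T : V → Set Plane),
      (∀ v, JoinedIn (T v) (D.pos v) w) ∧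
      ∀ v C, v ∉ C → Disjoint (T v) (D.carrierOn C) := by
  obtain ⟨w, hw, rfl⟩ := hF
  have hopen : IsOpen (connectedComponentIn D.carrierᶜ w) :=
    D.isClosed_carrier.isOpen_compl.connectedComponentIn
  have hpc : IsPathConnected (connectedComponentIn D.carrierᶜ w) :=
    hopen.isConnected_iff_isPathConnected.1 (isConnected_connectedComponentIn_iff.2 hw)
  have hball : ∀ v, ∃ r > 0, Disjoint (Metric.ball (D.pos v) r) (D.carrierOn {v}ᶜ) := by
    intro v
    obtain ⟨r, hr, h⟩ := Metric.isOpen_iff.1 (D.isClosed_carrierOn {v}ᶜ).isOpen_compl (D.pos v)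
      (D.pos_notMem_carrierOn (by simp))
    exact ⟨r, hr, Set.disjoint_left.2 fun x hx => h hx⟩
  choose r hr hd using hball
  -- The set for `v` is the face together with a small ball around `v`. The ball meets the face
  -- because `v` is on its boundary, and it is small enough to miss all of the drawing not incident
  -- with `v`.
  refine ⟨w, fun v => connectedComponentIn D.carrierᶜ w ∪ Metric.ball (D.pos v) (r v), fun v => ?_,
    fun v C hC => ?_⟩
  · obtain ⟨x, hx, hxF⟩ := Metric.mem_closure_iff.1 (frontier_subset_closure (hv v)) (r v) (hr v)
    refine JoinedIn.trans (y := x) (JoinedIn.mono (JoinedIn.of_segment_subset ?_)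
      Set.subset_union_right) ((hpc.joinedIn x hx w (mem_connectedComponentIn hw)).mono
      Set.subset_union_left)
    exact (convex_ball _ _).segment_subset (Metric.mem_ball_self (hr v))
      (Metric.mem_ball'.2 hxF)
  · refine Set.disjoint_union_left.2 ⟨?_, (hd v).mono_right (D.carrierOn_mono ?_)⟩
    · exact Set.disjoint_left.2 fun x hx hx' =>
        connectedComponentIn_subset _ _ hx (D.carrierOn_subset C hx')
    · rintro u hu rfl
      exact hC hu

end PlaneDrawing

/-- Identification of the Euclidean plane with the complex plane. -/
noncomputable def planeToComplex (x : Plane) : ℂ := ⟨x 0, x 1⟩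

theorem continuous_planeToComplex : Continuous planeToComplex := by
  have : planeToComplex = fun x : Plane => ((x 0 : ℝ) : ℂ) + (x 1 : ℝ) * Complex.I := by
    funext x
    exact Complex.ext (by simp [planeToComplex]) (by simp [planeToComplex])
  rw [this]
  fun_prop

theorem planeToComplex_injective : Function.Injective planeToComplex := by
  intro x y h
  ext i
  fin_cases i
  · exact congrArg Complex.re h
  · exact congrArg Complex.im h

/-- The apex in the face becomes a fifth vertex joined to a representative of each branch set; edges
between representatives run inside the drawing of the union of two branch sets. -/
theorem IsOuterplanar.not_hasMinor_complete_four [Finite V] {G : SimpleGraph V}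
    (hG : G.IsOuterplanar) : ¬ (⊤ : SimpleGraph (Fin 4)).HasMinor G := by
  rintro ⟨B, hB, hdis, hadj⟩
  obtain ⟨D, F, hF, -, hfr⟩ := hG
  obtain ⟨w, T, hT, hTd⟩ := D.exists_apex hF hfr
  choose r hr using fun i => (hB i).1
  have hw : ∀ i j k : Fin 4, k ≠ i → k ≠ j →
      Disjoint (T (r k)) (D.carrierOn (B i ∪ B j)) := fun i j k hi hj =>
    hTd _ _ fun h => h.elim (Set.disjoint_left.1 (hdis k i hi) (hr k))
      (Set.disjoint_left.1 (hdis k j hj) (hr k))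
  have hBd : ∀ i j k l : Fin 4, i ≠ k → i ≠ l → j ≠ k → j ≠ l →
      Disjoint (D.carrierOn (B i ∪ B j)) (D.carrierOn (B k ∪ B l)) := fun i j k l h1 h2 h3 h4 =>
    D.disjoint_carrierOn <| Set.disjoint_union_left.2
      ⟨Set.disjoint_union_right.2 ⟨hdis _ _ h1, hdis _ _ h2⟩,
        Set.disjoint_union_right.2 ⟨hdis _ _ h3, hdis _ _ h4⟩⟩
  -- The apex is the last index. The value `∅` is never used, since only pairs `i < j` need an edge.
  refine not_exists_drawing_five
    (fun i => planeToComplex (Fin.lastCases (motive := fun _ => Plane) w (fun i => D.pos (r i)) i))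
    (fun i j => planeToComplex '' Fin.lastCases (motive := fun _ => Set Plane) ∅ (fun i =>
      Fin.lastCases (motive := fun _ => Set Plane) (T (r i))
        (fun j => D.carrierOn (B i ∪ B j)) j) i) ?_ ?_
  · intro i j hij
    refine JoinedIn.map ?_ continuous_planeToComplex
    induction i using Fin.lastCases with
    | last => exact absurd hij (Fin.le_last j).not_gt
    | cast i =>
      induction j using Fin.lastCases with
      | last => simpa [-Fin.reduceLast] using hT (r i)
      | cast j =>
        simpa using D.joinedIn_carrierOn_union (hB i) (hB j) (hr i) (hr j)
          (hadj i j (by simpa using hij.ne))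
  · intro i j k l hij hkl h1 h2 h3 h4
    refine (Set.disjoint_image_iff planeToComplex_injective).2 ?_
    induction i using Fin.lastCases with
    | last => exact absurd hij (Fin.le_last j).not_gt
    | cast i =>
    induction k using Fin.lastCases with
    | last => exact absurd hkl (Fin.le_last l).not_gt
    | cast k =>
    induction j using Fin.lastCases with
    | last =>
      induction l using Fin.lastCases with
      | last => exact absurd rfl h4
      | cast l => simpa [-Fin.reduceLast] using hw k l i (by simpa using h1) (by simpa using h2)
    | cast j =>
      induction l using Fin.lastCases with
      | last => simpa [-Fin.reduceLast] using (hw i j k (by simpa using h1.symm) (by simpa using h3.symm)).symm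
      | cast l =>
        simpa using hBd i j k l (by simpa using h1) (by simpa using h2) (by simpa using h3)
          (by simpa using h4)

/-- Here the apex joins the class of size two, which completes `K₂,₃` to `K₃,₃`. -/
theorem IsOuterplanar.not_hasMinor_completeBipartite [Finite V] {G : SimpleGraph V}
    (hG : G.IsOuterplanar) : ¬ (completeBipartiteGraph (Fin 2) (Fin 3)).HasMinor G := by
  rintro ⟨B, hB, hdis, hadj⟩
  obtain ⟨D, F, hF, -, hfr⟩ := hG
  obtain ⟨w, T, hT, hTd⟩ := D.exists_apex hF hfr
  choose r hr using fun i => (hB i).1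
  have hw : ∀ i j k, k ≠ i → k ≠ j →
      Disjoint (T (r k)) (D.carrierOn (B i ∪ B j)) := fun i j k hi hj =>
    hTd _ _ fun h => h.elim (Set.disjoint_left.1 (hdis k i hi) (hr k))
      (Set.disjoint_left.1 (hdis k j hj) (hr k))
  have hBd : ∀ i j k l, i ≠ k → i ≠ l → j ≠ k → j ≠ l →
      Disjoint (D.carrierOn (B i ∪ B j)) (D.carrierOn (B k ∪ B l)) := fun i j k l h1 h2 h3 h4 =>
    D.disjoint_carrierOn <| Set.disjoint_union_left.2
      ⟨Set.disjoint_union_right.2 ⟨hdis _ _ h1, hdis _ _ h2⟩,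
        Set.disjoint_union_right.2 ⟨hdis _ _ h3, hdis _ _ h4⟩⟩
  refine not_exists_drawing_three_three
    (fun i => planeToComplex
      (Fin.lastCases (motive := fun _ => Plane) w (fun i => D.pos (r (.inl i))) i))
    (fun j => planeToComplex (D.pos (r (.inr j))))
    (fun i j => planeToComplex '' Fin.lastCases (motive := fun _ => Set Plane) (T (r (.inr j)))
      (fun i => D.carrierOn (B (.inl i) ∪ B (.inr j))) i) ?_ ?_
  · intro i j
    refine JoinedIn.map ?_ continuous_planeToComplex
    induction i using Fin.lastCases with
    | last => simpa [-Fin.reduceLast] using (hT (r (.inr j))).symm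
    | cast i =>
      simpa using D.joinedIn_carrierOn_union (hB _) (hB _) (hr (.inl i)) (hr (.inr j))
        (hadj _ _ (by simp))
  · intro i j k l h1 h2
    refine (Set.disjoint_image_iff planeToComplex_injective).2 ?_
    induction i using Fin.lastCases with
    | last =>
      induction k using Fin.lastCases with
      | last => exact absurd rfl h1
      | cast k => simpa [-Fin.reduceLast] using hw (.inl k) (.inr l) (.inr j) (by simp) (by simpa using h2)
    | cast i =>
      induction k using Fin.lastCases with
      | last =>
        simpa [-Fin.reduceLast] using (hw (.inl i) (.inr j) (.inr l) (by simp) (by simpa using h2.symm)).symm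
      | cast k =>
        simpa using hBd (.inl i) (.inr j) (.inl k) (.inr l) (by simpa using h1) (by simp)
          (by simp) (by simpa using h2)

end SimpleGraph

/-! ### Contractions, and vertices of small degree in graphs without a `K₄` minor -/

namespace SimpleGraph

variable {V W : Type*}

/-- Contraction of the pair `x`, `y` into `y`; the vertex `x` is kept as an isolated vertex. -/
def contract (G : SimpleGraph V) (x y : V) : SimpleGraph V where
  Adj u v := u ≠ v ∧ u ≠ x ∧ v ≠ x ∧ (G.Adj u v ∨ (u = y ∧ G.Adj x v) ∨ (v = y ∧ G.Adj x u))
  symm := ⟨fun u v h => ⟨h.1.symm, h.2.2.1, h.2.1, by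
    rcases h.2.2.2 with h | h | h
    · exact Or.inl h.symm
    · exact Or.inr (Or.inr h)
    · exact Or.inr (Or.inl h)⟩⟩
  loopless := ⟨fun u h => h.1 rfl⟩

/-- Put `x` back into the branch set that contains `y`, if there is one. As `K` has no isolated
vertex, the isolated vertex `x` of the contraction lies in no branch set beforehand. -/
theorem HasMinor.of_contract {K : SimpleGraph W} (hK : ∀ i, ∃ j, K.Adj i j)
    {G : SimpleGraph V} {x y : V} (hxy : G.Adj x y) (h : K.HasMinor (G.contract x y)) :
    K.HasMinor G := by
  obtain ⟨B, hB, hdis, hadj⟩ := h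
  have hx : ∀ i, x ∉ B i := by
    intro i hi
    obtain ⟨j, hij⟩ := hK i
    obtain ⟨u, hu, v, -, huv⟩ := hadj i j hij
    rcases Relation.ReflTransGen.cases_head ((hB i).2 x hi u hu) with h | ⟨c, h, -⟩
    · exact huv.2.1 h.symm
    · exact h.1.2.1 rfl
  set B' : W → Set V := fun i => {v | v ∈ B i ∨ (v = x ∧ y ∈ B i)} with hB'
  have hsub : ∀ i, B i ⊆ B' i := fun i v hv => Or.inl hv
  have hlink : ∀ i a b, (G.contract x y).Adj a b → a ∈ B i → b ∈ B i →
      G.LinkedIn (B' i) a b := by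
    rintro i a b ⟨-, -, -, h⟩ ha hb
    rcases h with h | ⟨rfl, h⟩ | ⟨rfl, h⟩
    · exact .single ⟨h, hsub i ha, hsub i hb⟩
    · exact .head ⟨hxy.symm, hsub i ha, Or.inr ⟨rfl, ha⟩⟩
        (.single ⟨h, Or.inr ⟨rfl, ha⟩, hsub i hb⟩)
    · exact .head ⟨h.symm, hsub i ha, Or.inr ⟨rfl, hb⟩⟩
        (.single ⟨hxy, Or.inr ⟨rfl, hb⟩, hsub i hb⟩)
  have hlink' : ∀ i a b, (G.contract x y).LinkedIn (B i) a b → G.LinkedIn (B' i) a b := by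
    intro i a b h
    induction h with
    | refl => exact .refl
    | tail _ h ih => exact ih.trans (hlink i _ _ h.1 h.2.1 h.2.2)
  refine ⟨B', fun i => ?_, fun i j hij => ?_, fun i j hij => ?_⟩
  · obtain ⟨r, hr⟩ := (hB i).1
    refine connectedOn_of_root (hsub i hr) ?_
    rintro v (hv | ⟨rfl, hy⟩)
    · exact hlink' i _ _ ((hB i).2 r hr v hv)
    · exact (hlink' i _ _ ((hB i).2 r hr y hy)).tail ⟨hxy.symm, hsub i hy, Or.inr ⟨rfl, hy⟩⟩
  · have hd := Set.disjoint_left.1 (hdis i j hij)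
    rw [Set.disjoint_left]
    rintro v (hv | ⟨rfl, hv⟩) (hv' | ⟨h, hv'⟩)
    · exact hd hv hv'
    · exact hx i (h ▸ hv)
    · exact hx j hv'
    · exact hd hv hv'
  · obtain ⟨u, hu, v, hv, -, -, -, h⟩ := hadj i j hij
    rcases h with h | ⟨rfl, h⟩ | ⟨rfl, h⟩
    · exact ⟨u, hsub i hu, v, hsub j hv, h⟩
    · exact ⟨x, Or.inr ⟨rfl, hu⟩, v, hsub j hv, h⟩
    · exact ⟨u, hsub i hu, x, Or.inr ⟨rfl, hv⟩, h.symm⟩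

/-- `v 0, …, v L` is a path in `G` inside `A`. -/
def IsPathIn (G : SimpleGraph V) (A : Set V) (v : ℕ → V) (L : ℕ) : Prop :=
  (∀ i ≤ L, v i ∈ A) ∧ (∀ i ≤ L, ∀ j ≤ L, v i = v j → i = j) ∧ ∀ i < L, G.Adj (v i) (v (i + 1))

namespace IsPathIn

variable {G : SimpleGraph V} {A : Set V} {v : ℕ → V} {L : ℕ}

theorem linkedIn_image (h : G.IsPathIn A v L) {a b i j : ℕ} (hb : b ≤ L) (hai : a ≤ i)
    (hij : i ≤ j) (hjb : j ≤ b) : G.LinkedIn (v '' Set.Icc a b) (v i) (v j) := by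
  induction j, hij using Nat.le_induction with
  | base => exact .refl
  | succ j hij ih =>
    exact (ih (by omega)).tail ⟨h.2.2 j (by omega), ⟨j, ⟨by omega, by omega⟩, rfl⟩,
      ⟨j + 1, ⟨by omega, by omega⟩, rfl⟩⟩

theorem connectedOn_image (h : G.IsPathIn A v L) {a b : ℕ} (hab : a ≤ b) (hb : b ≤ L) :
    G.ConnectedOn (v '' Set.Icc a b) := by
  refine connectedOn_of_root ⟨a, ⟨le_rfl, hab⟩, rfl⟩ ?_
  rintro _ ⟨j, hj, rfl⟩
  exact h.linkedIn_image hb le_rfl hj.1 hj.2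

theorem cons (h : G.IsPathIn A v L) {b : V} (hb : b ∈ A) (hadj : G.Adj b (v 0))
    (hne : ∀ i ≤ L, v i ≠ b) : G.IsPathIn A (fun n => Nat.casesOn n b v) (L + 1) := by
  refine ⟨?_, ?_, ?_⟩
  · rintro (_ | i) hi
    · exact hb
    · exact h.1 i (by omega)
  · rintro (_ | i) hi (_ | j) hj hij
    · rfl
    · exact absurd hij.symm (hne j (by omega))
    · exact absurd hij (hne i (by omega))
    · rw [h.2.1 i (by omega) j (by omega) hij]
  · rintro (_ | i) hi
    · exact hadj
    · exact h.2.2 i (by omega)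

/-- Reversal of an initial segment of a path whose first vertex is adjacent to `v i`. -/
theorem rotate (h : G.IsPathIn A v L) {i : ℕ} (hi : i ≤ L)
    (hadj : G.Adj (v 0) (v i)) : G.IsPathIn A (fun m => if m < i then v (i - 1 - m) else v m) L := by
  refine ⟨?_, ?_, ?_⟩
  · intro m hm
    dsimp only
    split_ifs
    · exact h.1 _ (by omega)
    · exact h.1 _ hm
  · intro m hm n hn hmn
    dsimp only at hmn
    split_ifs at hmn <;>
    · have := h.2.1 _ (by omega) _ (by omega) hmn
      omega
  · intro m hm
    dsimp only
    split_ifs with h1 h2 h2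
    · have := h.2.2 (i - 1 - (m + 1)) (by omega)
      rw [show i - 1 - (m + 1) + 1 = i - 1 - m by omega] at this
      exact this.symm
    · rw [show i - 1 - m = 0 by omega, show m + 1 = i by omega]
      exact hadj
    · omega
    · exact h.2.2 m hm

end IsPathIn

/-- A graph without a `K₄` minor has a vertex of degree at most two in every nonempty induced
subgraph. -/
theorem exists_ncard_neighbors_le_two [Finite V] {G : SimpleGraph V}
    (hG : ¬ (⊤ : SimpleGraph (Fin 4)).HasMinor G) {A : Set V} (hA : A.Nonempty) :
    ∃ a ∈ A, {b ∈ A | G.Adj a b}.ncard ≤ 2 := by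
  by_contra! hdeg
  obtain ⟨a, ha⟩ := hA
  have hex : ∃ L v, G.IsPathIn A v L :=
    ⟨0, fun _ => a, fun _ _ => ha, fun i hi j hj _ => by omega, fun i hi => by omega⟩
  have hbound : ∀ L, (∃ v, G.IsPathIn A v L) → L ≤ Nat.card V := by
    rintro L ⟨v, hv⟩
    have := Nat.card_le_card_of_injective (fun i : Fin (L + 1) => v i)
      (fun i j hij => Fin.ext (hv.2.1 i (by omega) j (by omega) hij))
    rw [Nat.card_eq_fintype_card, Fintype.card_fin] at this
    omega
  obtain ⟨L, ⟨v₀, hv₀⟩, hmax⟩ : ∃ L, (∃ v, G.IsPathIn A v L) ∧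
      ∀ L', (∃ v, G.IsPathIn A v L') → L' ≤ L := by
    classical
    obtain ⟨L, hL⟩ := hex
    exact ⟨Nat.findGreatest (fun L => ∃ v, G.IsPathIn A v L) (Nat.card V),
      Nat.findGreatest_spec (P := fun L => ∃ v, G.IsPathIn A v L) (hbound L hL) hL, fun L' h' => Nat.le_findGreatest (hbound L' h') h'⟩
  -- By maximality all neighbors of `v 0` in `A` lie on the path, and at least two of them differ
  -- from `v 1`.
  have hnbr : ∀ v, G.IsPathIn A v L → ∃ i j, 2 ≤ i ∧ i < j ∧ j ≤ L ∧ G.Adj (v 0) (v i) ∧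
      G.Adj (v 0) (v j) := by
    intro v hv
    have hon : ∀ b ∈ A, G.Adj (v 0) b → ∃ i, 1 ≤ i ∧ i ≤ L ∧ v i = b := by
      intro b hb hadj
      by_contra! hne
      have := hmax (L + 1) ⟨_, hv.cons hb hadj.symm fun i hi => by
        rcases Nat.eq_zero_or_pos i with rfl | h0
        · exact hadj.ne
        · exact hne i h0 hi⟩
      omega
    have hsub : {b ∈ A | G.Adj (v 0) b} \ {v 1} ⊆
        v '' {i | 2 ≤ i ∧ i ≤ L ∧ G.Adj (v 0) (v i)} := by
      rintro b ⟨⟨hb, hadj⟩, hb1⟩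
      obtain ⟨i, h1, h2, rfl⟩ := hon b hb hadj
      refine ⟨i, ⟨?_, h2, hadj⟩, rfl⟩
      rcases h1.eq_or_lt with rfl | h
      · exact absurd rfl hb1
      · exact h
    have hfin : {i | 2 ≤ i ∧ i ≤ L ∧ G.Adj (v 0) (v i)}.Finite :=
      (Set.finite_Iic L).subset fun i hi => hi.2.1
    have h1 := Set.ncard_le_ncard hsub (Set.toFinite _)
    have h2 := Set.ncard_image_le (f := v) hfin
    have h3 := hdeg (v 0) (hv.1 0 (by omega))
    have h4 := Set.pred_ncard_le_ncard_sdiff_singleton {b ∈ A | G.Adj (v 0) b} (v 1)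
    obtain ⟨i, hi, j, hj, hij⟩ := (Set.one_lt_ncard hfin).1 (by omega :
      1 < {i | 2 ≤ i ∧ i ≤ L ∧ G.Adj (v 0) (v i)}.ncard)
    rcases hij.lt_or_gt with h | h
    · exact ⟨i, j, hi.1, h, hj.2.1, hi.2.2, hj.2.2⟩
    · exact ⟨j, i, hj.1, h, hi.2.1, hj.2.2, hi.2.2⟩
  classical
  -- Among all longest paths take one whose first vertex has such a neighbor `v i` with `i` minimal.
  -- Rotating at `v i` gives another longest path, starting at `v (i - 1)`; minimality forces its
  -- first vertex to have a neighbor `v j'` with `j' > i`.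
  have hQ : ∃ i, ∃ v j, G.IsPathIn A v L ∧ 2 ≤ i ∧ i < j ∧ j ≤ L ∧ G.Adj (v 0) (v i) ∧
      G.Adj (v 0) (v j) := by
    obtain ⟨i, j, h⟩ := hnbr v₀ hv₀
    exact ⟨i, v₀, j, hv₀, h⟩
  obtain ⟨v, j, hv, hi2, hij, hjL, hi, hj⟩ := Nat.find_spec hQ
  set i := Nat.find hQ
  have hw := hv.rotate (by omega) hi
  obtain ⟨i', j', hi2', hij', hjL', hi', hj'⟩ := hnbr _ hw
  have hii' : i ≤ i' := Nat.find_min' hQ ⟨_, j', hw, hi2', hij', hjL', hi', hj'⟩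
  simp only [show 0 < i by omega, if_true, show ¬ j' < i by omega, if_false, Nat.sub_zero] at hj'
  have hdis : ∀ a b c d, b < c → d ≤ L →
      Disjoint (v '' Set.Icc a b) (v '' Set.Icc c d) := by
    intro a b c d hbc hd
    rw [Set.disjoint_left]
    rintro _ ⟨m, hm, rfl⟩ ⟨n, hn, hmn⟩
    have h1 := hm.2
    have h2 := hn.1
    have h3 := hn.2
    have := hv.2.1 n (by omega) m (by omega) hmn
    omega
  -- Branch sets of a `K₄` minor: `v 0`, the segment from `v 1` to `v (i - 1)`, `v i`, and the rest.
  -- The chords to `v j` and `v j'` provide the two edges into the last set from the first two.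
  let lo : Fin 4 → ℕ := ![0, 1, i, i + 1]
  let hi4 : Fin 4 → ℕ := ![0, i - 1, i, L]
  have hD : ∀ a b : Fin 4, a < b →
      Disjoint (v '' Set.Icc (lo a) (hi4 a)) (v '' Set.Icc (lo b) (hi4 b)) := by
    intro a b hab
    refine hdis _ _ _ _ ?_ ?_
    · fin_cases a <;> fin_cases b <;> simp [lo, hi4] at hab ⊢ <;> omega
    · fin_cases b <;> simp [hi4] <;> omega
  have hmem : ∀ m a b, a ≤ m → m ≤ b → v m ∈ v '' Set.Icc a b := fun m a b h1 h2 =>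
    ⟨m, ⟨h1, h2⟩, rfl⟩
  have hE : ∀ a b : Fin 4, a < b → ∃ x ∈ v '' Set.Icc (lo a) (hi4 a),
      ∃ y ∈ v '' Set.Icc (lo b) (hi4 b), G.Adj x y := by
    have h01 := hv.2.2 0 (by omega)
    have h12 := hv.2.2 (i - 1) (by omega)
    rw [show i - 1 + 1 = i by omega] at h12
    have h23 := hv.2.2 i (by omega)
    have e01 : ∃ x ∈ v '' Set.Icc 0 0, ∃ y ∈ v '' Set.Icc 1 (i - 1), G.Adj x y :=
      ⟨_, hmem 0 _ _ (by omega) (by omega), _, hmem 1 _ _ (by omega) (by omega), h01⟩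
    have e02 : ∃ x ∈ v '' Set.Icc 0 0, ∃ y ∈ v '' Set.Icc i i, G.Adj x y :=
      ⟨_, hmem 0 _ _ (by omega) (by omega), _, hmem i _ _ (by omega) (by omega), hi⟩
    have e03 : ∃ x ∈ v '' Set.Icc 0 0, ∃ y ∈ v '' Set.Icc (i + 1) L, G.Adj x y :=
      ⟨_, hmem 0 _ _ (by omega) (by omega), _, hmem j _ _ (by omega) (by omega), hj⟩
    have e12 : ∃ x ∈ v '' Set.Icc 1 (i - 1), ∃ y ∈ v '' Set.Icc i i, G.Adj x y :=
      ⟨_, hmem (i - 1) _ _ (by omega) (by omega), _, hmem i _ _ (by omega) (by omega), h12⟩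
    have e13 : ∃ x ∈ v '' Set.Icc 1 (i - 1), ∃ y ∈ v '' Set.Icc (i + 1) L, G.Adj x y :=
      ⟨_, hmem (i - 1) _ _ (by omega) (by omega), _, hmem j' _ _ (by omega) (by omega), hj'⟩
    have e23 : ∃ x ∈ v '' Set.Icc i i, ∃ y ∈ v '' Set.Icc (i + 1) L, G.Adj x y :=
      ⟨_, hmem i _ _ (by omega) (by omega), _, hmem (i + 1) _ _ (by omega) (by omega), h23⟩
    intro a b hab
    fin_cases a <;> fin_cases b <;> first
      | exact absurd hab (by decide)
      | exact e01 | exact e02 | exact e03 | exact e12 | exact e13 | exact e23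
  refine hG ⟨fun a => v '' Set.Icc (lo a) (hi4 a), fun a => ?_, fun a b hab => ?_,
    fun a b hab => ?_⟩
  · refine hv.connectedOn_image ?_ ?_ <;> fin_cases a <;> simp [lo, hi4] <;> omega
  · rcases hab.lt_or_gt with h | h
    · exact hD a b h
    · exact (hD b a h).symm
  · rcases hab.ne.lt_or_gt with h | h
    · exact hE a b h
    · obtain ⟨x, hx, y, hy, hxy⟩ := hE b a h
      exact ⟨y, hy, x, hx, hxy.symm⟩

end SimpleGraph

/-! ### Overlap of closed neighborhoods -/

namespace SimpleGraph

open Finset Classical in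
/-- The number of vertices of `D` in the closed neighborhood of `u`. -/
noncomputable def coverCount {V : Type*} (G : SimpleGraph V) (D : Finset V) (u : V) : ℕ :=
  #{v ∈ D | v = u ∨ G.Adj v u}

/-- The total number of superfluous coverings of vertices by closed neighborhoods of elements
of `D`. -/
noncomputable def coverExcess {V : Type*} [Fintype V] (G : SimpleGraph V) (D : Finset V) : ℕ :=
  ∑ u, (G.coverCount D u - 1)

theorem HasMinor.of_injective {V W : Type*} {K : SimpleGraph W} {G : SimpleGraph V} (f : W → V)
    (hf : Function.Injective f) (h : ∀ i j, K.Adj i j → G.Adj (f i) (f j)) : K.HasMinor G :=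
  ⟨fun i => {f i}, fun i => G.connectedOn_singleton (f i),
    fun _ _ hij => Set.disjoint_singleton.2 (hf.ne hij),
    fun _ _ hij => ⟨f _, rfl, f _, rfl, h _ _ hij⟩⟩

section

open Finset

variable {V : Type*} {G : SimpleGraph V} {D : Finset V} {x y u : V}

theorem coverCount_le_card : G.coverCount D u ≤ #D := by
  classical
  exact card_filter_le _ _

open Classical in
theorem coverCount_eq_erase_add : G.coverCount D u =
    G.coverCount (D.erase x) u + if x ∈ D ∧ (x = u ∨ G.Adj x u) then 1 else 0 := by
  unfold coverCount
  split_ifs with h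
  · rw [filter_erase, card_erase_add_one (mem_filter.2 h)]
  · rw [filter_erase, erase_eq_of_notMem (fun h' => h (mem_filter.1 h')), add_zero]

open Classical in
theorem coverCount_self (hx : x ∈ D) : G.coverCount D x = #{v ∈ D | G.Adj x v} + 1 := by
  unfold coverCount
  rw [← card_insert_of_notMem (s := {v ∈ D | G.Adj x v}) (a := x) (by simp)]
  congr 1
  ext v
  simp only [mem_filter, mem_insert, G.adj_comm v x]
  constructor
  · rintro ⟨h1, h2⟩; tauto
  · rintro (rfl | h) <;> tauto

theorem exists_of_coverCount_pos (h : 0 < G.coverCount D u) : ∃ v ∈ D, v = u ∨ G.Adj v u := by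
  classical
  obtain ⟨v, hv⟩ := card_pos.1 h
  exact ⟨v, (mem_filter.1 hv).1, (mem_filter.1 hv).2⟩

variable [Fintype V]

theorem sum_coverCount :
    ∑ u, G.coverCount D u = ∑ v ∈ D, ((G.neighborSet v).ncard + 1) := by
  classical
  unfold coverCount
  simp_rw [card_filter]
  rw [sum_comm]
  refine sum_congr rfl fun v _ => ?_
  rw [← card_filter, ← Set.ncard_insert_of_notMem (a := v) (by simp), ← Set.ncard_coe_finset]
  congr 1
  ext u
  simp [eq_comm]

-- Three common neighbors would form a `K₂,₃` subgraph with `x` and `y`.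
open Classical in
theorem card_common_neighbors_le_two
    (hG : ¬ (completeBipartiteGraph (Fin 2) (Fin 3)).HasMinor G) (hxy : x ≠ y) :
    #{u | G.Adj x u ∧ G.Adj y u} ≤ 2 := by
  by_contra! h
  obtain ⟨a, ha, b, hb, c, hc, hab, hac, hbc⟩ := Finset.two_lt_card.1 h
  simp only [mem_filter, mem_univ, true_and] at ha hb hc
  refine hG (HasMinor.of_injective (Sum.elim ![x, y] ![a, b, c]) ?_ ?_)
  · refine Function.Injective.sumElim ?_ ?_ ?_
    · intro i j hij
      fin_cases i <;> fin_cases j <;> simp_all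
    · intro i j hij
      fin_cases i <;> fin_cases j <;> simp_all
    · intro i j
      fin_cases i <;> fin_cases j <;> simp [ha.1.ne, ha.2.ne, hb.1.ne, hb.2.ne, hc.1.ne, hc.2.ne]
  · have key : ∀ i j, G.Adj (![x, y] i) (![a, b, c] j) := by
      intro i j
      fin_cases i <;> fin_cases j <;> simp [ha, hb, hc]
    rintro (i | i) (j | j) hij
    · simp at hij
    · exact key i j
    · exact (key j i).symm
    · simp at hij

-- Only `x`, `y` and their at most two common neighbors can be covered twice.
open Classical in
theorem coverExcess_le_of_card_eq_two
    (hG : ¬ (completeBipartiteGraph (Fin 2) (Fin 3)).HasMinor G) (hD : #D = 2) :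
    G.coverExcess D ≤ 4 := by
  obtain ⟨x, y, hxy, rfl⟩ := card_eq_two.1 hD
  have hpt : ∀ u, G.coverCount {x, y} u - 1 ≤ (if u = x then 1 else 0) + (if u = y then 1 else 0)
      + if G.Adj x u ∧ G.Adj y u then 1 else 0 := by
    intro u
    have h2 : G.coverCount {x, y} u ≤ 2 := coverCount_le_card.trans hD.le
    by_cases hux : u = x
    · simp only [hux, if_true]; subst hux; omega
    by_cases huy : u = y
    · simp only [huy, if_true]; subst huy; omega
    by_cases hc : G.Adj x u ∧ G.Adj y u
    · simp only [hc, and_self, if_true]; omega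
    simp only [hux, huy, hc, if_false]
    have : G.coverCount {x, y} u < #{x, y} := by
      refine card_lt_card (filter_ssubset.2 ?_)
      by_cases h : G.Adj x u
      · exact ⟨y, by simp, fun h' => h'.elim (fun h' => huy h'.symm) fun h' => hc ⟨h, h'⟩⟩
      · exact ⟨x, by simp, fun h' => h'.elim (fun h' => hux h'.symm) h⟩
    omega
  refine (sum_le_sum fun u _ => hpt u).trans ?_
  rw [sum_add_distrib, sum_add_distrib, sum_ite_eq' univ x, sum_ite_eq' univ y, ← card_filter]
  have := card_common_neighbors_le_two hG hxy
  simp only [mem_univ, if_true]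
  omega

-- After the contraction `y` covers what `x` or `y` covered before, so a vertex other than `x` loses
-- only if both covered it. That costs one at `y` and one at each of at most two common neighbors;
-- the vertex `x` itself loses its number of neighbors in `D`.
open Classical in
theorem coverExcess_le_contract_add
    (hG : ¬ (completeBipartiteGraph (Fin 2) (Fin 3)).HasMinor G) (hx : x ∈ D) (hy : y ∈ D)
    (hxy : G.Adj x y) :
    G.coverExcess D ≤ (G.contract x y).coverExcess (D.erase x) + #{v ∈ D | G.Adj x v} + 3 := by
  have hpt : ∀ u, G.coverCount D u - 1 ≤ ((G.contract x y).coverCount (D.erase x) u - 1)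
      + ((if u = x then #{v ∈ D | G.Adj x v} else 0) + (if u = y then 1 else 0)
      + if G.Adj x u ∧ G.Adj y u then 1 else 0) := by
    intro u
    by_cases hux : u = x
    · subst hux
      rw [coverCount_self hx]
      simp only [if_true]
      omega
    set S := {v ∈ D.erase x | v = u ∨ G.Adj v u} with hS
    set S' := {v ∈ D.erase x | v = u ∨ (G.contract x y).Adj v u} with hS'
    have hcount : G.coverCount D u = #S + if x ∈ D ∧ (x = u ∨ G.Adj x u) then 1 else 0 :=
      coverCount_eq_erase_add
    have hcount' : (G.contract x y).coverCount (D.erase x) u = #S' := rfl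
    have hsub : S ⊆ S' := by
      intro v hv
      simp only [hS, hS', mem_filter, mem_erase] at hv ⊢
      refine ⟨hv.1, hv.2.imp_right fun h => ⟨h.ne, hv.1.1, hux, Or.inl h⟩⟩
    have hle := card_le_card hsub
    by_cases hxu : G.Adj x u
    · have hyS' : y ∈ S' := by
        simp only [hS', mem_filter, mem_erase]
        refine ⟨⟨hxy.ne', hy⟩, ?_⟩
        by_cases h : y = u
        · exact Or.inl h
        · exact Or.inr ⟨h, hxy.ne', hux, Or.inr (Or.inl ⟨rfl, hxu⟩)⟩
      have hpos : 0 < #S' := card_pos.2 ⟨y, hyS'⟩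
      by_cases huy : u = y
      · simp only [huy, if_true] at hcount hcount' ⊢
        split_ifs at hcount ⊢ <;> omega
      by_cases hyu : G.Adj y u
      · simp only [hxu, hyu, and_self, if_true]
        split_ifs at hcount ⊢ <;> omega
      have hyS : y ∉ S := by
        simp only [hS, mem_filter, not_and, not_or]
        exact fun _ => ⟨fun h => huy h.symm, hyu⟩
      have h1 := card_le_card (insert_subset hyS' hsub)
      rw [card_insert_of_notMem hyS] at h1
      split_ifs at hcount ⊢ <;> omega
    · rw [if_neg (fun h => h.2.elim (fun h => hux h.symm) hxu)] at hcount
      omega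
  refine (sum_le_sum fun u _ => hpt u).trans ?_
  rw [sum_add_distrib, sum_add_distrib, sum_add_distrib, sum_ite_eq' univ x, sum_ite_eq' univ y,
    ← card_filter]
  have := card_common_neighbors_le_two hG hxy.ne
  simp only [mem_univ, if_true, coverExcess]
  omega

-- The merged vertex inherits all coverings of `u`, while `x` was covered only by itself and had
-- nothing to lose. The swap in the proof compares old `u` with new `x`, and old `x` with the
-- isolated `u`.
open Classical in
theorem coverExcess_le_contract (hx : x ∈ D) (hu : u ∉ D) (hxu : G.Adj x u)
    (hD : ∀ v ∈ D, ¬ G.Adj x v) : G.coverExcess D ≤ (G.contract u x).coverExcess D := by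
  unfold coverExcess
  rw [← Equiv.sum_comp (Equiv.swap u x) fun w => (G.contract u x).coverCount D w - 1]
  refine sum_le_sum fun w _ => ?_
  by_cases hwu : w = u
  · subst hwu
    rw [Equiv.swap_apply_left]
    refine Nat.sub_le_sub_right (card_le_card fun v hv => ?_) 1
    simp only [mem_filter] at hv ⊢
    have hvw : v ≠ w := fun h => hu (h ▸ hv.1)
    refine ⟨hv.1, or_iff_not_imp_left.2 fun h => ⟨h, hvw, hxu.ne, Or.inr (Or.inr ⟨rfl, ?_⟩)⟩⟩
    exact (hv.2.resolve_left hvw).symm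
  by_cases hwx : w = x
  · subst hwx
    rw [coverCount_self hx, filter_false_of_mem hD]
    simp
  rw [Equiv.swap_apply_of_ne_of_ne hwu hwx]
  refine Nat.sub_le_sub_right (card_le_card fun v hv => ?_) 1
  simp only [mem_filter] at hv ⊢
  exact ⟨hv.1, hv.2.imp_right fun h => ⟨h.ne, fun h' => hu (h' ▸ hv.1), hwu, Or.inl h⟩⟩

-- Neither `x` nor any of its neighbors is covered more than once, so removing `x` destroys no
-- superfluous covering.
open Classical in
theorem coverExcess_le_erase (hD : ∀ v ∈ D, ¬ G.Adj x v)
    (hN : ∀ u ∉ D, G.Adj x u → G.coverCount D u ≤ 1) :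
    G.coverExcess D ≤ G.coverExcess (D.erase x) := by
  refine sum_le_sum fun u _ => ?_
  have h := coverCount_eq_erase_add (G := G) (D := D) (x := x) (u := u)
  split_ifs at h with hxu
  · obtain ⟨hx, rfl | hxu⟩ := hxu
    · rw [coverCount_self hx, filter_false_of_mem hD]
      simp
    · have := hN u (fun hu => hD u hu hxu) hxu
      omega
  · omega

/-- In a graph without `K₄` and `K₂,₃` minors the closed neighborhoods of `k ≥ 2` vertices have
small overlap. -/
theorem coverExcess_add_six_le (hD : 2 ≤ #D) (h4 : ¬ (⊤ : SimpleGraph (Fin 4)).HasMinor G)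
    (h23 : ¬ (completeBipartiteGraph (Fin 2) (Fin 3)).HasMinor G) :
    G.coverExcess D + 6 ≤ 5 * #D := by
  classical
  have hcontract4 : ∀ {G : SimpleGraph V} {x y}, ¬ (⊤ : SimpleGraph (Fin 4)).HasMinor G →
      G.Adj x y → ¬ (⊤ : SimpleGraph (Fin 4)).HasMinor (G.contract x y) := fun h hxy h' =>
    h (h'.of_contract (fun i => ⟨i + 1, by fin_cases i <;> simp⟩) hxy)
  have hcontract23 : ∀ {G : SimpleGraph V} {x y},
      ¬ (completeBipartiteGraph (Fin 2) (Fin 3)).HasMinor G → G.Adj x y →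
      ¬ (completeBipartiteGraph (Fin 2) (Fin 3)).HasMinor (G.contract x y) := fun h hxy h' =>
    h (h'.of_contract (by rintro (i | i) <;> [exact ⟨.inr 0, by simp⟩; exact ⟨.inl 0, by simp⟩]) hxy)
  induction hk : #D using Nat.strong_induction_on generalizing G D with
  | _ k ihk =>
  -- Merging a vertex outside `D` into `x` leaves `D` unchanged. The second measure, the number of
  -- nonisolated vertices outside `D`, drops because the merged vertex stays behind as an isolated
  -- one.
  induction hm : #{w | w ∉ D ∧ ∃ v, G.Adj w v} using Nat.strong_induction_on generalizing G with
  | _ m ihm =>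
  subst hk
  -- The base case fixes the constant 6: for two vertices the excess is at most `4 = 5 * 2 - 6`.
  rcases hD.eq_or_lt with hD2 | hD3
  · have := coverExcess_le_of_card_eq_two h23 hD2.symm
    omega
  obtain ⟨x, hx, hdeg⟩ := exists_ncard_neighbors_le_two h4 (A := (D : Set V))
    (coe_nonempty.2 (card_pos.1 (by omega)))
  have hx : x ∈ D := hx
  have hcard : #{v ∈ D | G.Adj x v} ≤ 2 := by
    rw [← Set.ncard_coe_finset]
    simpa using hdeg
  have herase := card_erase_of_mem hx
  by_cases hnb : ∃ y ∈ D, G.Adj x y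
  · obtain ⟨y, hy, hxy⟩ := hnb
    have h1 := coverExcess_le_contract_add h23 hx hy hxy
    have h2 := ihk _ (by omega) (G := G.contract x y) (D := D.erase x) (by omega)
      (hcontract4 h4 hxy) (hcontract23 h23 hxy) rfl
    omega
  push Not at hnb
  by_cases hN : ∀ u ∉ D, G.Adj x u → G.coverCount D u ≤ 1
  · have h1 := coverExcess_le_erase hnb hN
    have h2 := ihk _ (by omega) (G := G) (D := D.erase x) (by omega) h4 h23 rfl
    omega
  · push Not at hN
    obtain ⟨u, hu, hxu, -⟩ := hN
    refine Nat.le_trans (Nat.add_le_add_right (coverExcess_le_contract hx hu hxu hnb) 6)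
      (ihm _ ?_ (hcontract4 h4 hxu.symm) (hcontract23 h23 hxu.symm) rfl)
    rw [← hm]
    refine card_lt_card (ssubset_iff_of_subset ?_ |>.2 ⟨u, ?_, ?_⟩)
    · intro w hw
      simp only [mem_filter, mem_univ, true_and] at hw ⊢
      obtain ⟨hw, v, -, -, -, h | ⟨rfl, -⟩ | ⟨-, h⟩⟩ := hw
      · exact ⟨hw, v, h⟩
      · exact absurd hx hw
      · exact ⟨hw, u, h.symm⟩
    · simpa using ⟨hu, x, hxu.symm⟩
    · simp only [mem_filter, mem_univ, true_and, not_and, not_exists]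
      exact fun _ v h => h.2.1 rfl

end

end SimpleGraph

/-! ### From the Slater number to a dominating set -/

namespace SimpleGraph

open Finset

/-- Lifts the sorted list of degrees to an enumeration of the vertices, so that an initial segment
of the degree sequence comes from an actual vertex set. -/
theorem exists_list_map_eq_of_coe_eq_map {α β : Type*} (f : α → β) (l : List β)
    (m : Multiset α) (h : (l : Multiset β) = m.map f) :
    ∃ L : List α, (L : Multiset α) = m ∧ L.map f = l := by
  classical
  induction l generalizing m with
  | nil => exact ⟨[], (Multiset.map_eq_zero.1 h.symm).symm, rfl⟩
  | cons b l ih =>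
    obtain ⟨a, ha, rfl⟩ := Multiset.mem_map.1 (h ▸ Multiset.mem_coe.2 List.mem_cons_self :
      b ∈ m.map f)
    obtain ⟨t, rfl⟩ := Multiset.exists_cons_of_mem ha
    rw [Multiset.map_cons, ← Multiset.cons_coe, Multiset.cons_inj_right] at h
    obtain ⟨L, rfl, rfl⟩ := ih t h
    exact ⟨a :: L, rfl, rfl⟩

variable {V : Type*} [Fintype V] (G : SimpleGraph V) [DecidableRel G.Adj]

theorem exists_card_eq_sum_eq_take_degreeSequence {s : ℕ} (hs : s ≤ Fintype.card V) :
    ∃ D : Finset V, #D = s ∧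
      ∑ v ∈ D, (G.degree v + 1) = ((G.degreeSequence.take s).map (· + 1)).sum := by
  classical
  obtain ⟨L, hL, hmap⟩ := exists_list_map_eq_of_coe_eq_map (fun v => G.degree v) G.degreeSequence
    univ.val (Multiset.sort_eq _ _)
  have hnd : L.Nodup := by
    rw [← Multiset.coe_nodup, hL]; exact univ.nodup
  have hlen : L.length = Fintype.card V := by
    rw [← Multiset.coe_card, hL]; rfl
  have hnd' : (L.take s).Nodup := hnd.sublist (List.take_sublist _ _)
  refine ⟨(L.take s).toFinset, ?_, ?_⟩
  · rw [List.toFinset_card_of_nodup hnd', List.length_take]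
    omega
  · rw [List.sum_toFinset _ hnd', ← hmap, ← List.map_take, List.map_map]
    rfl

theorem length_degreeSequence : G.degreeSequence.length = Fintype.card V := by
  rw [degreeSequence, Multiset.length_sort, Multiset.card_map]
  rfl

/-- There is a set whose order is the Slater number and whose closed neighborhoods have total
size at least the order of the graph. -/
theorem exists_card_eq_slaterNumber (hs : 2 ≤ G.slaterNumber) :
    ∃ D : Finset V, #D = G.slaterNumber ∧ Fintype.card V ≤ ∑ v ∈ D, (G.degree v + 1) := by
  have hmem := Nat.sInf_mem (Nat.nonempty_of_pos_sInf
    (show 0 < sInf _ from (by omega : 0 < G.slaterNumber)))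
  have hle : G.slaterNumber ≤ Fintype.card V := by
    -- For the empty graph `1` already qualifies, contradicting `hs`; otherwise the full degree
    -- sequence does.
    rcases Nat.eq_zero_or_pos (Fintype.card V) with h0 | hpos
    · have : G.slaterNumber ≤ 1 := Nat.sInf_le ⟨one_pos, by omega⟩
      omega
    · refine Nat.sInf_le ⟨hpos, ?_⟩
      rw [List.take_of_length_le G.length_degreeSequence.le, List.sum_map_add,
        List.map_const', List.sum_replicate, length_degreeSequence]
      simp
  obtain ⟨D, hD, hsum⟩ := G.exists_card_eq_sum_eq_take_degreeSequence hle
  exact ⟨D, hD, hsum ▸ hmem.2⟩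

theorem sum_degree_add_one_eq (D : Finset V) :
    ∑ v ∈ D, (G.degree v + 1) = ∑ u, G.coverCount D u := by
  rw [sum_coverCount]
  refine sum_congr rfl fun v _ => ?_
  rw [Set.ncard_eq_toFinset_card', Set.toFinset_card, card_neighborSet_eq_degree]

/-- Double counting: if `c` is the number of coverings of a vertex, then `c + [c = 0] = (c - 1) + 1`
with truncated subtraction. Summing over all vertices, with the sum of `c` at least `n`, bounds the
number of uncovered vertices by the excess. -/
theorem dominationNumber_le_card_add_coverExcess {D : Finset V}
    (hD : Fintype.card V ≤ ∑ v ∈ D, (G.degree v + 1)) :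
    G.dominationNumber ≤ #D + G.coverExcess D := by
  classical
  set U : Finset V := {u | G.coverCount D u = 0} with hU
  have hUle : #U ≤ G.coverExcess D := by
    have h1 : ∑ u, (G.coverCount D u + if G.coverCount D u = 0 then 1 else 0) =
        ∑ u, ((G.coverCount D u - 1) + 1) := sum_congr rfl fun u _ => by split_ifs <;> omega
    rw [sum_add_distrib, sum_add_distrib, ← card_filter, ← sum_degree_add_one_eq] at h1
    simp only [sum_const, card_univ, smul_eq_mul, mul_one] at h1
    rw [hU]
    unfold coverExcess
    omega
  have hdom : G.IsDominatingSet (D ∪ U) := by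
    intro v hv
    simp only [mem_union, not_or, hU, mem_filter, mem_univ, true_and] at hv
    obtain ⟨w, hw, rfl | h⟩ := exists_of_coverCount_pos (Nat.pos_of_ne_zero hv.2)
    · exact absurd hw hv.1
    · exact ⟨w, mem_union_left _ hw, h.symm⟩
  calc G.dominationNumber ≤ #(D ∪ U) := Nat.sInf_le ⟨_, hdom, rfl⟩
    _ ≤ #D + #U := card_union_le _ _
    _ ≤ _ := Nat.add_le_add_left hUle _

end SimpleGraph

theorem theorem7 {V : Type*} [Fintype V] (G : SimpleGraph V) [DecidableRel G.Adj]
    (hG : G.IsOuterplanar) (hs : 2 ≤ G.slaterNumber) :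
    (G.dominationNumber : ℤ) ≤ 6 * (G.slaterNumber : ℤ) - 6 := by
  obtain ⟨D, hD, hsum⟩ := G.exists_card_eq_slaterNumber hs
  have h1 := G.dominationNumber_le_card_add_coverExcess hsum
  have h2 := SimpleGraph.coverExcess_add_six_le (hD.symm ▸ hs) hG.not_hasMinor_complete_four
    hG.not_hasMinor_completeBipartite
  omega
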